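/- Let $\Omega=\{x\in\mathbb R^2: |x|<1\}$. For a continuous function $f$ on $\partial\Omega$ let $u_f$ be the solution of $\Delta u_f=0$ in $\Omega$, $u_f=f$ on $\partial\Omega$. For a real-valued $\gamma\in L^2(\Omega)$ the linearization at the constant conductivity $1$, in direction $\gamma$, of the Dirichlet-to-Neumann map of $-\operatorname{div}(\gamma\nabla u)$ is given by $$\langle \Lambda' f,g\rangle=\int_\Omega \gamma\,\nabla u_f\cdot\nabla u_g\,dx ,$$ and its coefficients in the trigonometric basis are the infinite matrices indexed by $i,j\ge 1$ $$\langle\Lambda'\cos(i\phi),\cos(j\phi)\rangle,\quad \langle\Lambda'\sin(i\phi),\sin(j\phi)\rangle,\quad \langle\Lambda'\sin(i\phi),\cos(j\phi)\rangle,\quad \langle\Lambda'\cos(i\phi),\sin(j\phi)\rangle,$$ where $\phi$ is the polar angle on $\partial\Omega$. Let $K^{cc},K^{ss},K^{sc},K^{cs}$ be infinite real matrices indexed by $i,j\geq 1$. For $n,k\ge 0$ put $$p_{n,k}=\sum_{l=0}^n 2(-1)^{n-l}(2n+k+1)\,\frac{\prod_{j=0}^{n-1}(1+k+l+j)}{l!\,(n-l)!}\;\frac{K^{cc}_{l+1,\,l+1+k}}{(l+1)(l+1+k)\pi},$$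 and define $q_{n,k}$ by the same formula with $K^{cs}$ in place of $K^{cc}$. Then there is a $\gamma\in L^2(\Omega)$ such that $K^{cc},K^{ss},K^{sc},K^{cs}$ are, respectively, the four matrices of coefficients of the linearized Dirichlet-to-Neumann map displayed above if and only if both of the following hold: 1. $K^{cc}$ and $K^{ss}$ are symmetric, $K^{cc}=K^{ss}$, $K^{cs}=(K^{sc})^T$, $K^{cs}=-(K^{cs})^T$ and $K^{sc}=-(K^{sc})^T$; 2. $$\sum_{n=0}^\infty\sum_{k=0}^\infty \frac{p_{n,k}^2}{2n+k+1}+\sum_{n=0}^\infty\sum_{k=1}^\infty \frac{q_{n,k}^2}{2n+k+1}<\infty .$$ -/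

import Mathlib

open MeasureTheory

noncomputable section

/-- The open unit disc of the plane, where the plane is identified with `ℂ` (as a real inner product
space with Lebesgue measure). -/
def unitDisc : Set ℂ := Metric.ball 0 1

/-- `u` solves the Dirichlet problem `Δ u = 0` in the unit disc, `u = f` on the unit circle: it is
harmonic in the disc, continuous on the closed disc, and has the boundary values `f`. -/
def IsDirichletSolution (f : Circle → ℝ) (u : ℂ → ℝ) : Prop :=
  InnerProductSpace.HarmonicContOnCl u unitDisc ∧ ∀ z : Circle, u z = f z

open Classical in
/-- The solution `u_f` of the Dirichlet problem for the Laplace equation in the unit disc with boundary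
values `f`.  For continuous `f` it exists and is unique on the closed disc. -/
def dirichletSolution (f : Circle → ℝ) : ℂ → ℝ :=
  if h : ∃ u, IsDirichletSolution f u then h.choose else 0

/-- The linearization `⟨Λ' f, g⟩ = ∫_Ω γ ∇u_f · ∇u_g dx` of the Dirichlet-to-Neumann map of
`-div (γ ∇ u)` at the constant conductivity `1`, in the direction `γ`. -/
def linearizedDtN (γ : ℂ → ℝ) (f g : Circle → ℝ) : ℝ :=
  ∫ x in unitDisc,
    γ x * inner ℝ (gradient (dirichletSolution f) x) (gradient (dirichletSolution g) x)

/-- The boundary function `cos (n φ)`. -/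
def cosBoundary (n : ℕ+) : Circle → ℝ := fun z => Real.cos (n * Complex.arg z)

/-- The boundary function `sin (n φ)`. -/
def sinBoundary (n : ℕ+) : Circle → ℝ := fun z => Real.sin (n * Complex.arg z)

/-- The coefficients `⟨Λ' cos (i φ), cos (j φ)⟩`, `i, j ≥ 1`. -/
def coeffCC (γ : ℂ → ℝ) : Matrix ℕ+ ℕ+ ℝ :=
  Matrix.of fun i j => linearizedDtN γ (cosBoundary i) (cosBoundary j)

/-- The coefficients `⟨Λ' sin (i φ), sin (j φ)⟩`, `i, j ≥ 1`. -/
def coeffSS (γ : ℂ → ℝ) : Matrix ℕ+ ℕ+ ℝ :=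
  Matrix.of fun i j => linearizedDtN γ (sinBoundary i) (sinBoundary j)

/-- The coefficients `⟨Λ' sin (i φ), cos (j φ)⟩`, `i, j ≥ 1`. -/
def coeffSC (γ : ℂ → ℝ) : Matrix ℕ+ ℕ+ ℝ :=
  Matrix.of fun i j => linearizedDtN γ (sinBoundary i) (cosBoundary j)

/-- The coefficients `⟨Λ' cos (i φ), sin (j φ)⟩`, `i, j ≥ 1`. -/
def coeffCS (γ : ℂ → ℝ) : Matrix ℕ+ ℕ+ ℝ :=
  Matrix.of fun i j => linearizedDtN γ (cosBoundary i) (sinBoundary j)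

/-- The coefficient of index `(n, k)` in the inversion formula,
`∑_{l=0}^n 2 (-1)^(n-l) (2n+k+1) ∏_{j=0}^{n-1} (1+k+l+j) / (l! (n-l)!)
  * K_{l+1,l+1+k} / ((l+1) (l+1+k) π)`.
It is `p_{n,k}` for `K = K^{cc}` and `q_{n,k}` for `K = K^{cs}`.  Here `l.succPNat` is the positive
integer `l + 1`, and `(l + k).succPNat` is `l + 1 + k`. -/
def inversionCoeff (K : Matrix ℕ+ ℕ+ ℝ) (n k : ℕ) : ℝ :=
  ∑ l ∈ Finset.range (n + 1),
    2 * (-1 : ℝ) ^ (n - l) * (2 * n + k + 1) *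
      ((∏ j ∈ Finset.range n, (1 + k + (l + j) : ℝ)) / (l.factorial * (n - l).factorial)) *
      (K l.succPNat (l + k).succPNat / ((l + 1) * (l + 1 + k) * Real.pi))

end

/-! The harmonic extensions of `cos (nφ)` and `sin (nφ)` are the real and imaginary parts of `z ^
n`, with gradients `conj (n z ^ (n-1))` and `I * conj (n z ^ (n-1))`. So all four matrices consist
of weighted moments of `γ`: after division by `(l+1)(l+1+k)`, the entries `(l+1, l+1+k)` of the cc
and cs matrices are the integrals of `γ` against `|z|^(2l) Re z^k` and `|z|^(2l) Im z^k`. The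
symmetries in condition 1 are visible in these formulas.

For fixed `k`, the inversion formula combines these moments with the coefficients of a radial
Zernike polynomial, so `p` and `q` are multiples of the pairings of `γ` with the Zernike functions
(`inversionCoeff_coeffCC`, `inversionCoeff_coeffCS`). These functions are orthogonal in `L²` of the
disc (`integral_zernike_mul`), with squared norms comparable to `1 / (2n+k+1)`. Bessel's inequality
gives the convergence in condition 2; conversely, a Riesz–Fischer series produces a `γ` with
prescribed pairings. Completeness of the Zernike system is not needed: for each `k` the passage from
matrix entries to `p` or `q` is triangular with nonzero diagonal, so `p`, `q` and the symmetries
determine the matrices. -/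

noncomputable section

/-! ### Algebraic orthogonality of the radial Zernike polynomials -/

/-- The coefficient of `t ^ l` in the radial Zernike polynomial of index `(n, k)`. -/
def zernikeCoeff (n k l : ℕ) : ℝ :=
  (-1) ^ (n - l) * ((∏ j ∈ Finset.range n, (1 + k + (l + j) : ℝ)) /
    (l.factorial * (n - l).factorial))

lemma nodalWeight_range_natCast {n l : ℕ} (hl : l ≤ n) :
    Lagrange.nodalWeight (Finset.range (n + 1)) (fun i : ℕ => (i : ℝ)) l =
      (-1) ^ (n - l) / (l.factorial * (n - l).factorial) := by
  have h1 : (Finset.range (n + 1)).erase l =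
      Finset.range l ∪ (Finset.range (n - l)).image (fun j => l + 1 + j) := by
    ext j
    simp only [Finset.mem_erase, Finset.mem_range, Finset.mem_union, Finset.mem_image]
    constructor
    · rintro ⟨h, h'⟩
      rcases lt_or_gt_of_ne h with h | h
      · exact Or.inl h
      · exact Or.inr ⟨j - (l + 1), by omega, by omega⟩
    · rintro (h | ⟨i, h, rfl⟩) <;> omega
  have h2 : ∏ j ∈ Finset.range l, ((l : ℝ) - j) = l.factorial := by
    rw [← Finset.prod_range_reflect, Nat.factorial_eq_prod_range_add_one, Nat.cast_prod]
    refine Finset.prod_congr rfl fun j hj => ?_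
    have : j < l := Finset.mem_range.1 hj
    rw [Nat.cast_sub (by omega), Nat.cast_sub (by omega)]
    push_cast; ring
  have h3 : ∏ j ∈ Finset.range (n - l), ((l : ℝ) - ((l + 1 + j : ℕ) : ℝ)) =
      (-1) ^ (n - l) * (n - l).factorial := by
    rw [Nat.factorial_eq_prod_range_add_one, Nat.cast_prod]
    conv_rhs => rw [← Finset.card_range (n - l), ← Finset.prod_const]
    rw [Finset.card_range, ← Finset.prod_mul_distrib]
    refine Finset.prod_congr rfl fun j _ => ?_
    push_cast; ring
  rw [Lagrange.nodalWeight, h1, Finset.prod_union, Finset.prod_image, Finset.prod_inv_distrib,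
    Finset.prod_inv_distrib, h2, h3]
  · rw [mul_inv, ← inv_pow, inv_neg, inv_one, div_eq_mul_inv, mul_inv]
    ring
  · intro a _ b _ h
    simpa using h
  · rw [Finset.disjoint_left]
    intro a ha hb
    simp only [Finset.mem_image, Finset.mem_range] at ha hb
    obtain ⟨i, _, rfl⟩ := hb
    omega

/-- Partial fractions: Lagrange interpolation at the nodes `0, …, n` reproduces `Q` because of its
degree, and is then evaluated at `-x`. -/
lemma sum_eval_div_add {n : ℕ} {Q : Polynomial ℝ} (hQ : Q.degree < (n + 1 : ℕ)) {x : ℝ}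
    (hx : 0 < x) :
    ∑ l ∈ Finset.range (n + 1),
      (-1) ^ (n - l) / (l.factorial * (n - l).factorial) * (Q.eval (l : ℝ) / (x + l)) =
      (-1) ^ n * Q.eval (-x) / ∏ j ∈ Finset.range (n + 1), (x + j) := by
  have hinj : Set.InjOn (fun i : ℕ => (i : ℝ)) (Finset.range (n + 1)) :=
    Nat.cast_injective.injOn
  have h := Lagrange.eq_interpolate (f := Q) hinj (by simpa using hQ)
  have hP : ∏ j ∈ Finset.range (n + 1), (x + j) ≠ 0 :=
    Finset.prod_ne_zero_iff.2 fun j _ => by positivity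
  rw [eq_div_iff hP]
  conv_rhs => rw [h]
  rw [Lagrange.eval_interpolate_not_at_node]
  · have hn : (Lagrange.nodal (Finset.range (n + 1)) fun i : ℕ => (i : ℝ)).eval (-x) =
        (-1) ^ (n + 1) * ∏ j ∈ Finset.range (n + 1), (x + j) := by
      rw [Lagrange.eval_nodal]
      conv_rhs => rw [← Finset.card_range (n + 1), ← Finset.prod_const]
      rw [Finset.card_range, ← Finset.prod_mul_distrib]
      exact Finset.prod_congr rfl fun j _ => by ring
    have hs : ∑ l ∈ Finset.range (n + 1),
        Lagrange.nodalWeight (Finset.range (n + 1)) (fun i : ℕ => (i : ℝ)) l *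
          (-x - (l : ℝ))⁻¹ * Q.eval (l : ℝ) = -∑ l ∈ Finset.range (n + 1),
      (-1) ^ (n - l) / (l.factorial * (n - l).factorial) * (Q.eval (l : ℝ) / (x + l)) := by
      rw [← Finset.sum_neg_distrib]
      refine Finset.sum_congr rfl fun l hl => ?_
      rw [nodalWeight_range_natCast (by simpa [Nat.lt_succ_iff] using hl),
        show -x - (l : ℝ) = -(x + l) by ring, inv_neg]
      ring
    rw [hn, hs]
    have h1 : ((-1 : ℝ) ^ n) * (-1) ^ n = 1 := by rw [← mul_pow]; simp
    linear_combination (-(∏ j ∈ Finset.range (n + 1), (x + (j : ℝ))) * ∑ l ∈ Finset.range (n + 1),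
      (-1) ^ (n - l) / (l.factorial * (n - l).factorial) * (Q.eval (l : ℝ) / (x + l))) * h1
  · intro i _ h
    have : (0 : ℝ) ≤ i := Nat.cast_nonneg i
    linarith

/-- `zernikeCoeff n k l` is a nodal weight times the value at `l` of `Q = ∏ (X + 1 + k + j)`. At `x
= k + s + 1` the factors of `Q (-x)` are `j - s`, so the sum vanishes for `s < n`: this is
orthogonality to lower powers. -/
lemma sum_zernikeCoeff_div (n k s : ℕ) :
    ∑ l ∈ Finset.range (n + 1), zernikeCoeff n k l / (k + s + 1 + l) =
      (-1) ^ n * (∏ j ∈ Finset.range n, ((j : ℝ) - s)) /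
        ∏ j ∈ Finset.range (n + 1), ((k : ℝ) + s + 1 + j) := by
  set Q : Polynomial ℝ := ∏ j ∈ Finset.range n, (Polynomial.X + Polynomial.C (1 + k + j : ℝ))
    with hQ
  have hdeg : Q.degree < (n + 1 : ℕ) := by
    rw [hQ, Polynomial.degree_prod]
    simp only [Polynomial.degree_X_add_C, Finset.sum_const, Finset.card_range, nsmul_eq_mul,
      mul_one]
    exact_mod_cast Nat.lt_succ_self n
  have h := sum_eval_div_add hdeg (show (0 : ℝ) < k + s + 1 by positivity)
  convert h using 1
  · refine Finset.sum_congr rfl fun l _ => ?_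
    rw [zernikeCoeff, hQ, Polynomial.eval_prod]
    simp only [Polynomial.eval_add, Polynomial.eval_X, Polynomial.eval_C]
    rw [Finset.prod_congr rfl fun (j : ℕ) _ => show (1 + k + (l + j) : ℝ) = l + (1 + k + j) by ring]
    ring
  · congr 2
    rw [hQ, Polynomial.eval_prod]
    refine Finset.prod_congr rfl fun j _ => ?_
    simp only [Polynomial.eval_add, Polynomial.eval_X, Polynomial.eval_C]
    ring

lemma sum_zernikeCoeff_div_of_lt {n k s : ℕ} (h : s < n) :
    ∑ l ∈ Finset.range (n + 1), zernikeCoeff n k l / (k + s + 1 + l) = 0 := by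
  rw [sum_zernikeCoeff_div, Finset.prod_eq_zero (Finset.mem_range.2 h) (sub_self _)]
  simp

lemma zernikeCoeff_self_ne_zero (n k : ℕ) : zernikeCoeff n k n ≠ 0 := by
  have : ∏ j ∈ Finset.range n, (1 + k + (n + j) : ℝ) ≠ 0 :=
    Finset.prod_ne_zero_iff.2 fun j _ => by positivity
  rw [zernikeCoeff]
  simp [this, Nat.factorial_ne_zero]

lemma zernikeCoeff_self_mul_sum (n k : ℕ) :
    zernikeCoeff n k n * ∑ l ∈ Finset.range (n + 1), zernikeCoeff n k l / (k + n + 1 + l) =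
      1 / (2 * n + k + 1) := by
  have h1 : ∏ j ∈ Finset.range n, ((j : ℝ) - n) = (-1) ^ n * n.factorial := by
    rw [← Finset.prod_range_reflect, Nat.factorial_eq_prod_range_add_one, Nat.cast_prod]
    conv_rhs => rw [← Finset.card_range n, ← Finset.prod_const]
    rw [Finset.card_range, ← Finset.prod_mul_distrib]
    refine Finset.prod_congr rfl fun j hj => ?_
    have : j < n := Finset.mem_range.1 hj
    rw [Nat.cast_sub (by omega), Nat.cast_sub (by omega)]
    push_cast; ring
  have h2 : ∏ j ∈ Finset.range n, ((k : ℝ) + n + 1 + j) ≠ 0 :=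
    Finset.prod_ne_zero_iff.2 fun j _ => by positivity
  have h3 : ((-1 : ℝ) ^ n) * (-1) ^ n = 1 := by rw [← mul_pow]; simp
  have h4 : (n.factorial : ℝ) ≠ 0 := by exact_mod_cast n.factorial_ne_zero
  rw [sum_zernikeCoeff_div, h1, ← mul_assoc, h3, Finset.prod_range_succ, zernikeCoeff,
    Finset.prod_congr rfl fun (j : ℕ) _ => show (1 + k + (n + j) : ℝ) = k + n + 1 + j by ring]
  have h5 : (k : ℝ) + n + 1 + n ≠ 0 := by positivity
  have h6 : (2 * n + k + 1 : ℝ) ≠ 0 := by positivity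
  simp only [Nat.sub_self, pow_zero, Nat.factorial_zero, Nat.cast_one]
  field_simp
  ring

lemma sum_sum_zernikeCoeff_of_lt {n m : ℕ} (k : ℕ) (h : m < n) :
    ∑ l ∈ Finset.range (n + 1), ∑ s ∈ Finset.range (m + 1),
      zernikeCoeff n k l * zernikeCoeff m k s / (k + s + 1 + l) = 0 := by
  rw [Finset.sum_comm]
  refine Finset.sum_eq_zero fun s hs => ?_
  have h1 := sum_zernikeCoeff_div_of_lt (k := k) (show s < n by have := Finset.mem_range.1 hs; omega)
  rw [Finset.sum_congr rfl fun l _ => show zernikeCoeff n k l * zernikeCoeff m k s /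
    ((k : ℝ) + s + 1 + l) = zernikeCoeff m k s * (zernikeCoeff n k l / (k + s + 1 + l)) by ring,
    ← Finset.mul_sum, h1, mul_zero]

/-- The denominators are the moments `∫₀¹ t ^ (k+s+l) dt`, so this is orthogonality for the weight
`t ^ k`. On the diagonal only the leading term `s = n` survives. -/
lemma sum_sum_zernikeCoeff (n m k : ℕ) :
    ∑ l ∈ Finset.range (n + 1), ∑ s ∈ Finset.range (m + 1),
      zernikeCoeff n k l * zernikeCoeff m k s / (k + s + 1 + l) =
      if n = m then 1 / (2 * n + k + 1 : ℝ) else 0 := by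
  rcases lt_trichotomy n m with h | rfl | h
  · rw [if_neg h.ne, ← sum_sum_zernikeCoeff_of_lt k h, Finset.sum_comm]
    refine Finset.sum_congr rfl fun l _ => Finset.sum_congr rfl fun s _ => ?_
    rw [mul_comm, show (k : ℝ) + l + 1 + s = k + s + 1 + l by ring]
  · rw [if_pos rfl, Finset.sum_comm, Finset.sum_range_succ, Finset.sum_eq_zero, zero_add,
      ← zernikeCoeff_self_mul_sum, Finset.mul_sum]
    · exact Finset.sum_congr rfl fun l _ => by ring
    · intro s hs
      have h1 := sum_zernikeCoeff_div_of_lt (k := k) (Finset.mem_range.1 hs)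
      rw [Finset.sum_congr rfl fun l _ => show zernikeCoeff n k l * zernikeCoeff n k s /
        ((k : ℝ) + s + 1 + l) = zernikeCoeff n k s * (zernikeCoeff n k l / (k + s + 1 + l)) by ring,
        ← Finset.mul_sum, h1, mul_zero]
  · rw [if_neg h.ne', sum_sum_zernikeCoeff_of_lt k h]

/-! ### Harmonic extensions and the matrix entries as moments -/

open InnerProductSpace in
lemma harmonicContOnCl_ball_eqOn {u v : ℂ → ℝ} {c : ℂ} {R : ℝ}
    (hu : HarmonicContOnCl u (Metric.ball c R)) (hv : HarmonicContOnCl v (Metric.ball c R))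
    (h : Set.EqOn u v (Metric.sphere c |R|)) : Set.EqOn u v (Metric.ball c R) := by
  intro w hw
  rw [← hu.circleAverage_poissonKernel_smul hw, ← hv.circleAverage_poissonKernel_smul hw]
  refine Real.circleAverage_congr_sphere fun z hz => ?_
  simp only [Pi.smul_apply', h hz]

/-- The chosen solution is pinned down on the disc by uniqueness, through the Poisson formula;
agreement on this open set suffices for gradients. -/
lemma dirichletSolution_eqOn {f : Circle → ℝ} {u : ℂ → ℝ} (hu : IsDirichletSolution f u) :
    Set.EqOn (dirichletSolution f) u unitDisc := by
  have hex : ∃ u, IsDirichletSolution f u := ⟨u, hu⟩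
  have hd : IsDirichletSolution f (dirichletSolution f) := by
    rw [dirichletSolution, dif_pos hex]
    exact hex.choose_spec
  refine harmonicContOnCl_ball_eqOn hd.1 hu.1 fun z hz => ?_
  have hz' : ‖z‖ = 1 := by simpa using hz
  have h1 := hd.2 ⟨z, by simp [Submonoid.unitSphere, hz']⟩
  have h2 := hu.2 ⟨z, by simp [Submonoid.unitSphere, hz']⟩
  exact h1.trans h2.symm

lemma circle_pow_eq (z : Circle) (n : ℕ) : (z : ℂ) ^ n =
    Real.cos (n * (z : ℂ).arg) + Real.sin (n * (z : ℂ).arg) * Complex.I := by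
  conv_lhs => rw [← Complex.norm_mul_exp_arg_mul_I (z : ℂ)]
  rw [Circle.norm_coe, Complex.ofReal_one, one_mul, ← Complex.exp_nat_mul,
    Complex.ofReal_cos, Complex.ofReal_sin, ← Complex.exp_mul_I]
  congr 1
  push_cast
  ring

lemma isDirichletSolution_cosBoundary (n : ℕ+) :
    IsDirichletSolution (cosBoundary n) fun z => (z ^ (n : ℕ)).re := by
  refine ⟨⟨fun z _ => AnalyticAt.harmonicAt_re (by fun_prop), by fun_prop⟩, fun z => ?_⟩
  simp [circle_pow_eq, -Complex.ofReal_cos, -Complex.ofReal_sin, cosBoundary]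

lemma isDirichletSolution_sinBoundary (n : ℕ+) :
    IsDirichletSolution (sinBoundary n) fun z => (z ^ (n : ℕ)).im := by
  refine ⟨⟨fun z _ => AnalyticAt.harmonicAt_im (by fun_prop), by fun_prop⟩, fun z => ?_⟩
  simp [circle_pow_eq, -Complex.ofReal_cos, -Complex.ofReal_sin, sinBoundary]

/-- The real inner product on `ℂ` is `Re (conj a * b)`, so `Re (f' w)` is the pairing of `conj f'`
with `w`. -/
lemma HasDerivAt.hasGradientAt_re {f : ℂ → ℂ} {f' z : ℂ} (h : HasDerivAt f f' z) :
    HasGradientAt (fun w => (f w).re) (starRingEnd ℂ f') z := by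
  rw [hasGradientAt_iff_hasFDerivAt]
  refine (Complex.reCLM.hasFDerivAt.comp z h.complexToReal_fderiv).congr_fderiv ?_
  ext
  simp [Complex.inner]
  ring

lemma HasDerivAt.hasGradientAt_im {f : ℂ → ℂ} {f' z : ℂ} (h : HasDerivAt f f' z) :
    HasGradientAt (fun w => (f w).im) (Complex.I * starRingEnd ℂ f') z := by
  rw [hasGradientAt_iff_hasFDerivAt]
  refine (Complex.imCLM.hasFDerivAt.comp z h.complexToReal_fderiv).congr_fderiv ?_
  ext
  simp [Complex.inner]
  ring

lemma gradient_dirichletSolution {f : Circle → ℝ} {u : ℂ → ℝ} {g x : ℂ}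
    (hu : IsDirichletSolution f u) (hg : HasGradientAt u g x) (hx : x ∈ unitDisc) :
    gradient (dirichletSolution f) x = g := by
  rw [← hg.gradient]
  exact ((dirichletSolution_eqOn hu).eventuallyEq_of_mem
    (Metric.isOpen_ball.mem_nhds hx)).gradient_eq

lemma gradient_dirichletSolution_cosBoundary (n : ℕ+) {x : ℂ} (hx : x ∈ unitDisc) :
    gradient (dirichletSolution (cosBoundary n)) x =
      starRingEnd ℂ (n * x ^ ((n : ℕ) - 1)) :=
  gradient_dirichletSolution (isDirichletSolution_cosBoundary n)
    (hasDerivAt_pow (n : ℕ) x).hasGradientAt_re hx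

lemma gradient_dirichletSolution_sinBoundary (n : ℕ+) {x : ℂ} (hx : x ∈ unitDisc) :
    gradient (dirichletSolution (sinBoundary n)) x =
      Complex.I * starRingEnd ℂ (n * x ^ ((n : ℕ) - 1)) :=
  gradient_dirichletSolution (isDirichletSolution_sinBoundary n)
    (hasDerivAt_pow (n : ℕ) x).hasGradientAt_im hx

lemma measurableSet_unitDisc : MeasurableSet unitDisc := Metric.isOpen_ball.measurableSet

lemma coeffCC_apply (γ : ℂ → ℝ) (i j : ℕ+) : coeffCC γ i j = ∫ x in unitDisc,
    γ x * (i * j * (x ^ ((i : ℕ) - 1) * starRingEnd ℂ (x ^ ((j : ℕ) - 1))).re) := by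
  refine setIntegral_congr_fun measurableSet_unitDisc fun x hx => ?_
  simp only [gradient_dirichletSolution_cosBoundary _ hx]
  generalize x ^ ((i : ℕ) - 1) = a
  generalize x ^ ((j : ℕ) - 1) = b
  congr 1
  simp only [Complex.inner, Complex.mul_re, Complex.mul_im, Complex.conj_re, Complex.conj_im,
    map_mul, Complex.natCast_re, Complex.natCast_im]
  ring

lemma coeffSS_apply (γ : ℂ → ℝ) (i j : ℕ+) : coeffSS γ i j = ∫ x in unitDisc,
    γ x * (i * j * (x ^ ((i : ℕ) - 1) * starRingEnd ℂ (x ^ ((j : ℕ) - 1))).re) := by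
  refine setIntegral_congr_fun measurableSet_unitDisc fun x hx => ?_
  simp only [gradient_dirichletSolution_sinBoundary _ hx]
  generalize x ^ ((i : ℕ) - 1) = a
  generalize x ^ ((j : ℕ) - 1) = b
  congr 1
  simp only [Complex.inner, Complex.mul_re, Complex.mul_im, Complex.conj_re, Complex.conj_im,
    Complex.I_re, Complex.I_im, map_mul, Complex.natCast_re, Complex.natCast_im]
  ring

lemma coeffCS_apply (γ : ℂ → ℝ) (i j : ℕ+) : coeffCS γ i j = ∫ x in unitDisc,
    γ x * (i * j * (starRingEnd ℂ (x ^ ((i : ℕ) - 1)) * x ^ ((j : ℕ) - 1)).im) := by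
  refine setIntegral_congr_fun measurableSet_unitDisc fun x hx => ?_
  simp only [gradient_dirichletSolution_sinBoundary _ hx,
    gradient_dirichletSolution_cosBoundary _ hx]
  generalize x ^ ((i : ℕ) - 1) = a
  generalize x ^ ((j : ℕ) - 1) = b
  congr 1
  simp only [Complex.inner, Complex.mul_re, Complex.mul_im, Complex.conj_re, Complex.conj_im,
    Complex.I_re, Complex.I_im, map_mul, Complex.natCast_re, Complex.natCast_im]
  ring

lemma coeffSC_apply (γ : ℂ → ℝ) (i j : ℕ+) : coeffSC γ i j = ∫ x in unitDisc,
    γ x * (i * j * (x ^ ((i : ℕ) - 1) * starRingEnd ℂ (x ^ ((j : ℕ) - 1))).im) := by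
  refine setIntegral_congr_fun measurableSet_unitDisc fun x hx => ?_
  simp only [gradient_dirichletSolution_sinBoundary _ hx,
    gradient_dirichletSolution_cosBoundary _ hx]
  generalize x ^ ((i : ℕ) - 1) = a
  generalize x ^ ((j : ℕ) - 1) = b
  congr 1
  simp only [Complex.inner, Complex.mul_re, Complex.mul_im, Complex.conj_re, Complex.conj_im,
    Complex.I_re, Complex.I_im, map_mul, Complex.natCast_re, Complex.natCast_im]
  ring

lemma isSymm_coeffCC (γ : ℂ → ℝ) : (coeffCC γ).IsSymm := by
  ext i j
  rw [Matrix.transpose_apply, coeffCC_apply, coeffCC_apply]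
  refine integral_congr_ae (.of_forall fun x => ?_)
  simp only [Complex.mul_re, Complex.conj_re, Complex.conj_im]
  ring

lemma coeffCC_eq_coeffSS (γ : ℂ → ℝ) : coeffCC γ = coeffSS γ := by
  ext i j
  rw [coeffCC_apply, coeffSS_apply]

lemma coeffCS_eq_transpose (γ : ℂ → ℝ) : coeffCS γ = (coeffSC γ).transpose := by
  ext i j
  rw [Matrix.transpose_apply, coeffCS_apply, coeffSC_apply]
  refine integral_congr_ae (.of_forall fun x => ?_)
  simp only [Complex.mul_im, Complex.conj_re, Complex.conj_im]
  ring

lemma coeffCS_eq_neg_transpose (γ : ℂ → ℝ) : coeffCS γ = -(coeffCS γ).transpose := by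
  ext i j
  rw [Matrix.neg_apply, Matrix.transpose_apply, coeffCS_apply, coeffCS_apply, ← integral_neg]
  refine integral_congr_ae (.of_forall fun x => ?_)
  simp only [Complex.mul_im, Complex.conj_re, Complex.conj_im]
  ring

/-- Here `z^l * conj (z^(l+k)) = |z|^(2l) * conj (z^k)`. -/
lemma coeffCC_succPNat (γ : ℂ → ℝ) (l k : ℕ) :
    coeffCC γ l.succPNat (l + k).succPNat =
      (l + 1) * (l + 1 + k) * ∫ x in unitDisc, γ x * ((‖x‖ ^ 2) ^ l * (x ^ k).re) := by
  rw [coeffCC_apply, ← integral_const_mul]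
  refine integral_congr_ae (.of_forall fun x => ?_)
  simp only [Nat.succPNat_coe, Nat.succ_sub_one, Nat.succ_eq_add_one]
  rw [pow_add, map_mul, ← mul_assoc (x ^ l), map_pow _ _ l, ← mul_pow, Complex.mul_conj, Complex.normSq_eq_norm_sq,
    ← Complex.ofReal_pow, Complex.re_ofReal_mul, Complex.conj_re]
  push_cast
  ring

lemma coeffCS_succPNat (γ : ℂ → ℝ) (l k : ℕ) :
    coeffCS γ l.succPNat (l + k).succPNat =
      (l + 1) * (l + 1 + k) * ∫ x in unitDisc, γ x * ((‖x‖ ^ 2) ^ l * (x ^ k).im) := by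
  rw [coeffCS_apply, ← integral_const_mul]
  refine integral_congr_ae (.of_forall fun x => ?_)
  simp only [Nat.succPNat_coe, Nat.succ_sub_one, Nat.succ_eq_add_one]
  rw [pow_add, ← mul_assoc (starRingEnd ℂ _), map_pow, ← mul_pow, mul_comm (starRingEnd ℂ x), Complex.mul_conj,
    Complex.normSq_eq_norm_sq, ← Complex.ofReal_pow, Complex.im_ofReal_mul]
  push_cast
  ring

/-! ### Polar coordinates and trigonometric integrals -/

lemma setIntegral_unitDisc_eq_mul {f : ℂ → ℝ} {g h : ℝ → ℝ}
    (H : ∀ r θ : ℝ, f (r * (Real.cos θ + Real.sin θ * Complex.I)) = g r * h θ) :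
    ∫ x in unitDisc, f x =
      (∫ r in (0 : ℝ)..1, r * g r) * ∫ θ in -Real.pi..Real.pi, h θ := by
  have h1 : ∀ p ∈ polarCoord.target,
      p.1 • unitDisc.indicator f (Complex.polarCoord.symm p) =
        (Set.Iio 1).indicator (fun r => r * g r) p.1 * h p.2 := by
    intro p hp
    have hp1 : 0 < p.1 := hp.1
    by_cases hp2 : p.1 < 1
    · rw [Set.indicator_of_mem, Set.indicator_of_mem (by exact hp2), Complex.polarCoord_symm_apply,
        H, smul_eq_mul, mul_assoc]
      rw [unitDisc, mem_ball_zero_iff, Complex.norm_polarCoord_symm, abs_of_pos hp1]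
      exact hp2
    · rw [Set.indicator_of_notMem, Set.indicator_of_notMem (by exact hp2), smul_zero, zero_mul]
      rw [unitDisc, mem_ball_zero_iff, Complex.norm_polarCoord_symm, abs_of_pos hp1]
      exact hp2
  have hm : MeasurableSet polarCoord.target :=
    polarCoord.open_target.measurableSet
  rw [← integral_indicator measurableSet_unitDisc, ← Complex.integral_comp_polarCoord_symm,
    setIntegral_congr_fun (s := polarCoord.target) hm h1,
    polarCoord_target, Measure.volume_eq_prod, setIntegral_prod_mul,
    setIntegral_indicator measurableSet_Iio, Set.Ioi_inter_Iio,
    intervalIntegral.integral_of_le zero_le_one, integral_Ioc_eq_integral_Ioo,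
    intervalIntegral.integral_of_le (by linarith [Real.pi_pos]), integral_Ioc_eq_integral_Ioo]

lemma integral_cos_int_mul (m : ℤ) :
    ∫ θ in -Real.pi..Real.pi, Real.cos (m * θ) = if m = 0 then 2 * Real.pi else 0 := by
  split_ifs with h
  · simp [h]; ring
  · have h' : (m : ℝ) ≠ 0 := by exact_mod_cast h
    rw [intervalIntegral.integral_comp_mul_left _ h', integral_cos]
    simp [Real.sin_int_mul_pi]

lemma integral_sin_int_mul (m : ℤ) :
    ∫ θ in -Real.pi..Real.pi, Real.sin (m * θ) = 0 := by
  rcases eq_or_ne m 0 with h | h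
  · simp [h]
  · have h' : (m : ℝ) ≠ 0 := by exact_mod_cast h
    rw [intervalIntegral.integral_comp_mul_left _ h', integral_sin]
    simp

lemma integral_cos_mul_cos (k m : ℕ) :
    ∫ θ in -Real.pi..Real.pi, Real.cos (k * θ) * Real.cos (m * θ) =
      if k = m then (if k = 0 then 2 * Real.pi else Real.pi) else 0 := by
  have h : ∀ θ : ℝ, Real.cos (k * θ) * Real.cos (m * θ) =
      1 / 2 * (Real.cos (((k - m : ℤ) : ℝ) * θ) + Real.cos (((k + m : ℤ) : ℝ) * θ)) := by
    intro θ
    push_cast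
    rw [sub_mul, add_mul, Real.cos_sub, Real.cos_add]
    ring
  simp_rw [h]
  rw [intervalIntegral.integral_const_mul, intervalIntegral.integral_add
    (Continuous.intervalIntegrable (by fun_prop) _ _)
    (Continuous.intervalIntegrable (by fun_prop) _ _), integral_cos_int_mul, integral_cos_int_mul]
  split_ifs <;> first | omega | ring

/-- The bound on `k` excludes `k = m = 0`, where the integral is `0` and not `π`. -/
lemma integral_sin_mul_sin {k m : ℕ} (hk : 1 ≤ k) :
    ∫ θ in -Real.pi..Real.pi, Real.sin (k * θ) * Real.sin (m * θ) =
      if k = m then Real.pi else 0 := by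
  have h : ∀ θ : ℝ, Real.sin (k * θ) * Real.sin (m * θ) =
      1 / 2 * (Real.cos (((k - m : ℤ) : ℝ) * θ) - Real.cos (((k + m : ℤ) : ℝ) * θ)) := by
    intro θ
    push_cast
    rw [sub_mul, add_mul, Real.cos_sub, Real.cos_add]
    ring
  simp_rw [h]
  rw [intervalIntegral.integral_const_mul, intervalIntegral.integral_sub
    (Continuous.intervalIntegrable (by fun_prop) _ _)
    (Continuous.intervalIntegrable (by fun_prop) _ _), integral_cos_int_mul, integral_cos_int_mul]
  split_ifs <;> first | omega | ring

lemma integral_cos_mul_sin (k m : ℕ) :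
    ∫ θ in -Real.pi..Real.pi, Real.cos (k * θ) * Real.sin (m * θ) = 0 := by
  have h : ∀ θ : ℝ, Real.cos (k * θ) * Real.sin (m * θ) =
      1 / 2 * (Real.sin (((k + m : ℤ) : ℝ) * θ) - Real.sin (((k - m : ℤ) : ℝ) * θ)) := by
    intro θ
    push_cast
    rw [sub_mul, add_mul, Real.sin_sub, Real.sin_add]
    ring
  simp_rw [h]
  rw [intervalIntegral.integral_const_mul, intervalIntegral.integral_sub
    (Continuous.intervalIntegrable (by fun_prop) _ _)
    (Continuous.intervalIntegrable (by fun_prop) _ _), integral_sin_int_mul, integral_sin_int_mul]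
  simp

/-! ### Zernike functions as an orthogonal family in `L²` -/

/-- The radial Zernike polynomial of index `(n, k)`, divided by `r ^ k`, as a function of `r`. -/
def zernikeRadial (n k : ℕ) (r : ℝ) : ℝ :=
  ∑ l ∈ Finset.range (n + 1), zernikeCoeff n k l * (r ^ 2) ^ l

lemma continuous_zernikeRadial (n k : ℕ) : Continuous (zernikeRadial n k) := by
  unfold zernikeRadial
  fun_prop

lemma integral_zernikeRadial_mul (n m k : ℕ) :
    ∫ r in (0 : ℝ)..1, r * (zernikeRadial n k r * r ^ k * (zernikeRadial m k r * r ^ k)) =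
      if n = m then 1 / (2 * (2 * n + k + 1) : ℝ) else 0 := by
  have h : ∀ r : ℝ, r * (zernikeRadial n k r * r ^ k * (zernikeRadial m k r * r ^ k)) =
      ∑ l ∈ Finset.range (n + 1), ∑ s ∈ Finset.range (m + 1),
        zernikeCoeff n k l * zernikeCoeff m k s * r ^ (2 * (k + s + l) + 1) := by
    intro r
    rw [zernikeRadial, zernikeRadial,
      show ∀ a b : ℝ, r * (a * r ^ k * (b * r ^ k)) = a * b * r ^ (2 * k + 1) by intros; ring,
      Finset.sum_mul_sum, Finset.sum_mul]
    refine Finset.sum_congr rfl fun l _ => ?_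
    rw [Finset.sum_mul]
    refine Finset.sum_congr rfl fun s _ => ?_
    ring
  simp_rw [h]
  rw [intervalIntegral.integral_finsetSum fun l _ =>
    Continuous.intervalIntegrable (by fun_prop) _ _]
  -- The factor `1 / 2` is the Jacobian of `t = r ^ 2`.
  have h2 : ∀ l ∈ Finset.range (n + 1), ∫ r in (0 : ℝ)..1, ∑ s ∈ Finset.range (m + 1),
      zernikeCoeff n k l * zernikeCoeff m k s * r ^ (2 * (k + s + l) + 1) =
      1 / 2 * ∑ s ∈ Finset.range (m + 1),
        zernikeCoeff n k l * zernikeCoeff m k s / (k + s + 1 + l) := by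
    intro l _
    rw [intervalIntegral.integral_finsetSum fun l _ =>
      Continuous.intervalIntegrable (by fun_prop) _ _, Finset.mul_sum]
    refine Finset.sum_congr rfl fun s _ => ?_
    rw [intervalIntegral.integral_const_mul, integral_pow]
    push_cast
    have : (k + s + 1 + l : ℝ) ≠ 0 := by positivity
    have h3 : (2 * (k + s + l) + 1 + 1 : ℝ) ≠ 0 := by positivity
    simp only [one_pow, ne_eq, Nat.add_eq_zero_iff, one_ne_zero, and_false, not_false_eq_true,
      zero_pow, sub_zero]
    field_simp
    ring
  rw [Finset.sum_congr rfl h2, ← Finset.mul_sum, sum_sum_zernikeCoeff]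
  split_ifs
  · rw [div_mul_div_comm, one_mul]
  · simp

/-- The indices of the Zernike functions: cosine functions on the left, sine functions on the
right. -/
abbrev ZernikeIndex : Type := (ℕ × ℕ) ⊕ (ℕ × {k : ℕ // 1 ≤ k})

/-- The (unnormalized) Zernike functions of the disc. -/
def zernike : ZernikeIndex → ℂ → ℝ
  | .inl (n, k), z => zernikeRadial n k ‖z‖ * (z ^ k).re
  | .inr (n, k), z => zernikeRadial n k ‖z‖ * (z ^ (k : ℕ)).im

/-- The square of the `L²` norm of a Zernike function. -/
def zernikeNormSq : ZernikeIndex → ℝ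
  | .inl (n, k) => 1 / (2 * (2 * n + k + 1)) * (if k = 0 then 2 * Real.pi else Real.pi)
  | .inr (n, k) => 1 / (2 * (2 * n + (k : ℕ) + 1)) * Real.pi

lemma zernikeNormSq_pos (i : ZernikeIndex) : 0 < zernikeNormSq i := by
  rcases i with ⟨n, k⟩ | ⟨n, k⟩
  · simp only [zernikeNormSq]
    split_ifs <;> positivity
  · simp only [zernikeNormSq]
    positivity

lemma continuous_zernike (i : ZernikeIndex) : Continuous (zernike i) := by
  rcases i with ⟨n, k⟩ | ⟨n, k⟩
  · exact ((continuous_zernikeRadial n k).comp continuous_norm).mul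
      (Complex.continuous_re.comp (continuous_pow k))
  · exact ((continuous_zernikeRadial n k).comp continuous_norm).mul
      (Complex.continuous_im.comp (continuous_pow (k : ℕ)))

lemma polar_pow (r θ : ℝ) (k : ℕ) :
    ((r * (Real.cos θ + Real.sin θ * Complex.I) : ℂ)) ^ k =
      (r ^ k : ℝ) * (Real.cos (k * θ) + Real.sin (k * θ) * Complex.I) := by
  rw [mul_pow, Complex.ofReal_cos, Complex.ofReal_sin, Complex.cos_add_sin_mul_I_pow]
  push_cast
  rfl

lemma zernikeRadial_norm_polar (n k : ℕ) (r θ : ℝ) :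
    zernikeRadial n k ‖(r * (Real.cos θ + Real.sin θ * Complex.I) : ℂ)‖ =
      zernikeRadial n k r := by
  have h : ‖(r * (Real.cos θ + Real.sin θ * Complex.I) : ℂ)‖ = |r| :=
    (congrArg norm (Complex.polarCoord_symm_apply (r, θ))).symm.trans
      (Complex.norm_polarCoord_symm (r, θ))
  rw [h, zernikeRadial, sq_abs, zernikeRadial]

lemma zernike_inl_polar (n k : ℕ) (r θ : ℝ) :
    zernike (.inl (n, k)) (r * (Real.cos θ + Real.sin θ * Complex.I)) =
      zernikeRadial n k r * r ^ k * Real.cos (k * θ) := by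
  rw [zernike, zernikeRadial_norm_polar, polar_pow, Complex.re_ofReal_mul]
  simp [mul_assoc, -Complex.ofReal_cos, -Complex.ofReal_sin]

lemma zernike_inr_polar (n : ℕ) (k : {k : ℕ // 1 ≤ k}) (r θ : ℝ) :
    zernike (.inr (n, k)) (r * (Real.cos θ + Real.sin θ * Complex.I)) =
      zernikeRadial n k r * r ^ (k : ℕ) * Real.sin ((k : ℕ) * θ) := by
  rw [zernike, zernikeRadial_norm_polar, polar_pow, Complex.im_ofReal_mul]
  simp [mul_assoc, -Complex.ofReal_cos, -Complex.ofReal_sin]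

lemma integral_zernike_inl_mul_inr (p : ℕ × ℕ) (q : ℕ × {k : ℕ // 1 ≤ k}) :
    ∫ x in unitDisc, zernike (.inl p) x * zernike (.inr q) x = 0 := by
  obtain ⟨n, k⟩ := p
  obtain ⟨m, j⟩ := q
  rw [setIntegral_unitDisc_eq_mul
    (g := fun r => zernikeRadial n k r * r ^ k * (zernikeRadial m j r * r ^ (j : ℕ)))
    (h := fun θ => Real.cos (k * θ) * Real.sin ((j : ℕ) * θ)), integral_cos_mul_sin, mul_zero]
  intro r θ
  rw [zernike_inl_polar, zernike_inr_polar]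
  ring

lemma integral_zernike_mul (i j : ZernikeIndex) :
    ∫ x in unitDisc, zernike i x * zernike j x = if i = j then zernikeNormSq i else 0 := by
  rcases i with ⟨n, k⟩ | ⟨n, k⟩ <;> rcases j with ⟨m, j⟩ | ⟨m, j⟩
  · rw [setIntegral_unitDisc_eq_mul
      (g := fun r => zernikeRadial n k r * r ^ k * (zernikeRadial m j r * r ^ j))
      (h := fun θ => Real.cos (k * θ) * Real.cos (j * θ)), integral_cos_mul_cos]
    · by_cases hk : k = j
      · subst hk
        rw [integral_zernikeRadial_mul]
        by_cases hn : n = m <;> simp [hn, zernikeNormSq]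
      · simp [hk]
    · intro r θ
      rw [zernike_inl_polar, zernike_inl_polar]
      ring
  · rw [integral_zernike_inl_mul_inr]
    simp
  · simp_rw [mul_comm (zernike (.inr _) _)]
    rw [integral_zernike_inl_mul_inr]
    simp
  · rw [setIntegral_unitDisc_eq_mul
      (g := fun r => zernikeRadial n k r * r ^ (k : ℕ) * (zernikeRadial m j r * r ^ (j : ℕ)))
      (h := fun θ => Real.sin ((k : ℕ) * θ) * Real.sin ((j : ℕ) * θ)), integral_sin_mul_sin k.2]
    · by_cases hk : k = j
      · subst hk
        rw [integral_zernikeRadial_mul]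
        by_cases hn : n = m <;> simp [hn, zernikeNormSq]
      · have hk' : (k : ℕ) ≠ j := fun h => hk (Subtype.ext h)
        simp [hk, hk']
    · intro r θ
      rw [zernike_inr_polar, zernike_inr_polar]
      ring

lemma Continuous.memLp_unitDisc {f : ℂ → ℝ} (hf : Continuous f) :
    MemLp f 2 (volume.restrict unitDisc) := by
  obtain ⟨C, hC⟩ := (isCompact_closedBall (0 : ℂ) 1).exists_bound_of_continuousOn hf.continuousOn
  have : IsFiniteMeasure (volume.restrict unitDisc) :=
    ⟨by simp [unitDisc]⟩
  refine MemLp.of_bound hf.aestronglyMeasurable C ?_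
  exact (ae_restrict_iff' measurableSet_unitDisc).2
    (.of_forall fun x hx => hC x (Metric.ball_subset_closedBall hx))

/-- The normalized Zernike functions, as elements of `L²` of the disc. -/
def zernikeLp (i : ZernikeIndex) : Lp ℝ 2 (volume.restrict unitDisc) :=
  (√(zernikeNormSq i))⁻¹ • (continuous_zernike i).memLp_unitDisc.toLp

lemma inner_zernikeLp (i : ZernikeIndex) {γ : ℂ → ℝ}
    (hγ : MemLp γ 2 (volume.restrict unitDisc)) :
    inner ℝ (zernikeLp i) hγ.toLp =
      (√(zernikeNormSq i))⁻¹ * ∫ x in unitDisc, γ x * zernike i x := by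
  rw [zernikeLp, real_inner_smul_left, L2.inner_def]
  congr 1
  refine integral_congr_ae ?_
  filter_upwards [hγ.coeFn_toLp, (continuous_zernike i).memLp_unitDisc.coeFn_toLp] with x h1 h2
  rw [h1, h2, real_inner_eq_re_inner, RCLike.inner_apply]
  simp

lemma orthonormal_zernikeLp : Orthonormal ℝ zernikeLp := by
  classical
  rw [orthonormal_iff_ite]
  intro i j
  have h : zernikeLp j =
      (√(zernikeNormSq j))⁻¹ • (continuous_zernike j).memLp_unitDisc.toLp := rfl
  rw [h, real_inner_smul_right, inner_zernikeLp]
  simp_rw [mul_comm (zernike j _)]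
  rw [integral_zernike_mul]
  split_ifs with hij
  · subst hij
    have h1 := Real.mul_self_sqrt (zernikeNormSq_pos i).le
    have h2 := (Real.sqrt_pos.2 (zernikeNormSq_pos i)).ne'
    field_simp
    linarith
  · simp

/-! ### Bessel and Riesz–Fischer for the scaled coefficients -/

/-- The factor `2 n + k + 1` attached to a Zernike function. -/
def zernikeWeight : ZernikeIndex → ℝ
  | .inl (n, k) => 2 * n + k + 1
  | .inr (n, k) => 2 * n + (k : ℕ) + 1

lemma zernikeWeight_pos (i : ZernikeIndex) : 0 < zernikeWeight i := by
  rcases i with ⟨n, k⟩ | ⟨n, k⟩ <;> simp only [zernikeWeight] <;> positivity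

/-- The product is `π` for cosine functions with `k = 0` and `π / 2` otherwise; these bounds make
the weighted series equivalent to the `ℓ²` norm of the orthonormal coefficients. -/
lemma zernikeWeight_mul_zernikeNormSq_mem_Icc (i : ZernikeIndex) :
    zernikeWeight i * zernikeNormSq i ∈ Set.Icc (Real.pi / 2) Real.pi := by
  have hπ := Real.pi_pos
  have h : ∀ w a : ℝ, 0 < w → w * (1 / (2 * w) * a) = a / 2 := by
    intro w a hw
    field_simp
  rcases i with ⟨n, k⟩ | ⟨n, k⟩ <;> simp only [zernikeWeight, zernikeNormSq] <;>
    rw [h _ _ (by positivity)]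
  · split_ifs <;> constructor <;> linarith
  · constructor <;> linarith

/-- The Zernike coefficients of `γ`, scaled as in the inversion formula. -/
def zernikeTransform (γ : ℂ → ℝ) (i : ZernikeIndex) : ℝ :=
  2 * zernikeWeight i / Real.pi * ∫ x in unitDisc, γ x * zernike i x

lemma zernikeTransform_eq_inner (i : ZernikeIndex) {γ : ℂ → ℝ}
    (hγ : MemLp γ 2 (volume.restrict unitDisc)) :
    zernikeTransform γ i =
      2 * zernikeWeight i / Real.pi * √(zernikeNormSq i) * inner ℝ (zernikeLp i) hγ.toLp := by
  rw [inner_zernikeLp, zernikeTransform, mul_assoc, mul_inv_cancel_left₀]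
  exact (Real.sqrt_pos.2 (zernikeNormSq_pos i)).ne'

lemma one_div_zernikeWeight_mul_sq (i : ZernikeIndex) (c : ℝ) :
    1 / zernikeWeight i * (2 * zernikeWeight i / Real.pi * √(zernikeNormSq i) * c) ^ 2 =
      4 / Real.pi ^ 2 * (zernikeWeight i * zernikeNormSq i) * c ^ 2 := by
  have h := zernikeWeight_pos i
  have h1 := Real.sq_sqrt (zernikeNormSq_pos i).le
  rw [mul_pow, mul_pow, h1]
  field_simp
  ring

lemma summable_zernikeTransform_sq {γ : ℂ → ℝ} (hγ : MemLp γ 2 (volume.restrict unitDisc)) :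
    Summable fun i => 1 / zernikeWeight i * zernikeTransform γ i ^ 2 := by
  have h := (orthonormal_zernikeLp.inner_products_summable (x := hγ.toLp)).mul_left
    (4 / Real.pi ^ 2 * Real.pi)
  refine Summable.of_nonneg_of_le (fun i => ?_) (fun i => ?_) h
  · have := zernikeWeight_pos i
    positivity
  · rw [zernikeTransform_eq_inner i hγ, one_div_zernikeWeight_mul_sq, Real.norm_eq_abs, sq_abs]
    have := (zernikeWeight_mul_zernikeNormSq_mem_Icc i).2
    gcongr

/-- Riesz–Fischer: square summability makes `∑ c i • v i` converge, and its inner products are read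
off termwise. -/
lemma Orthonormal.exists_inner_eq {ι E : Type*} [NormedAddCommGroup E] [InnerProductSpace ℝ E]
    [CompleteSpace E] {v : ι → E} (hv : Orthonormal ℝ v) {c : ι → ℝ}
    (hc : Summable fun i => c i ^ 2) : ∃ x : E, ∀ i, inner ℝ (v i) x = c i := by
  classical
  have hs : Summable fun i => c i • v i := by
    have h := hv.orthogonalFamily.summable_iff_norm_sq_summable c
    simp only [LinearIsometry.toSpanSingleton_apply, Real.norm_eq_abs, sq_abs] at h
    exact h.2 hc
  refine ⟨∑' i, c i • v i, fun i => ?_⟩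
  have h := hs.hasSum.mapL (innerSL ℝ (v i))
  have h1 := h.unique (hasSum_single i fun j hj => ?_)
  · simpa [inner_smul_right, hv.1 i] using h1
  · simp [hv.2 hj.symm]

lemma exists_zernikeTransform_eq {P : ZernikeIndex → ℝ}
    (hP : Summable fun i => 1 / zernikeWeight i * P i ^ 2) :
    ∃ γ : ℂ → ℝ, MemLp γ 2 (volume.restrict unitDisc) ∧ ∀ i, zernikeTransform γ i = P i := by
  set s : ZernikeIndex → ℝ := fun i => 2 * zernikeWeight i / Real.pi * √(zernikeNormSq i) with hs
  have hs0 : ∀ i, s i ≠ 0 := fun i => by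
    have h1 := zernikeWeight_pos i
    have h2 := Real.sqrt_pos.2 (zernikeNormSq_pos i)
    have h3 := Real.pi_pos
    exact (by positivity : 0 < s i).ne'
  have hc : Summable fun i => (P i / s i) ^ 2 := by
    refine Summable.of_nonneg_of_le (fun i => sq_nonneg _) (fun i => ?_)
      -- The constant inverts `4 / π² * (π / 2)`, which uses the lower bound `π / 2` of weight times
      -- squared norm.
      (hP.mul_left (Real.pi / 2))
    have h := one_div_zernikeWeight_mul_sq i (P i / s i)
    change 1 / zernikeWeight i * (s i * (P i / s i)) ^ 2 = _ at h
    rw [mul_div_cancel₀ _ (hs0 i)] at h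
    rw [h]
    have h1 := (zernikeWeight_mul_zernikeNormSq_mem_Icc i).1
    have h3 := Real.pi_pos
    calc (P i / s i) ^ 2 =
        Real.pi / 2 * (4 / Real.pi ^ 2 * (Real.pi / 2) * (P i / s i) ^ 2) := by
          field_simp
          ring
      _ ≤ _ := by gcongr
  obtain ⟨x, hx⟩ := orthonormal_zernikeLp.exists_inner_eq hc
  refine ⟨x, Lp.memLp x, fun i => ?_⟩
  rw [zernikeTransform_eq_inner i (Lp.memLp x), Lp.toLp_coeFn, hx]
  exact mul_div_cancel₀ _ (hs0 i)

/-! ### Inversion coefficients and recovery of the matrices -/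

lemma inversionCoeff_eq (K : Matrix ℕ+ ℕ+ ℝ) (n k : ℕ) :
    inversionCoeff K n k = 2 * (2 * n + k + 1) / Real.pi * ∑ l ∈ Finset.range (n + 1),
      zernikeCoeff n k l * (K l.succPNat (l + k).succPNat / ((l + 1) * (l + 1 + k))) := by
  rw [inversionCoeff, Finset.mul_sum]
  refine Finset.sum_congr rfl fun l _ => ?_
  rw [zernikeCoeff, ← div_div _ _ Real.pi]
  ring

lemma integral_mul_zernikeRadial_mul {γ g : ℂ → ℝ} (hγ : MemLp γ 2 (volume.restrict unitDisc))
    (hg : Continuous g) (n k : ℕ) :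
    ∫ x in unitDisc, γ x * (zernikeRadial n k ‖x‖ * g x) =
      ∑ l ∈ Finset.range (n + 1),
        zernikeCoeff n k l * ∫ x in unitDisc, γ x * ((‖x‖ ^ 2) ^ l * g x) := by
  have hi : ∀ l : ℕ, Integrable (fun x => γ x * ((‖x‖ ^ 2) ^ l * g x))
      (volume.restrict unitDisc) := fun l =>
    hγ.integrable_mul (Continuous.memLp_unitDisc (by fun_prop))
  simp_rw [← integral_const_mul]
  rw [← integral_finsetSum _ fun l _ => (hi l).const_mul _]
  refine integral_congr_ae (.of_forall fun x => ?_)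
  simp only [zernikeRadial, Finset.sum_mul, Finset.mul_sum]
  exact Finset.sum_congr rfl fun l _ => by ring

lemma inversionCoeff_coeffCC {γ : ℂ → ℝ} (hγ : MemLp γ 2 (volume.restrict unitDisc)) (n k : ℕ) :
    inversionCoeff (coeffCC γ) n k = zernikeTransform γ (.inl (n, k)) := by
  rw [inversionCoeff_eq, zernikeTransform]
  simp only [zernikeWeight, zernike]
  rw [integral_mul_zernikeRadial_mul hγ (by fun_prop)]
  congr 1
  refine Finset.sum_congr rfl fun l _ => ?_
  rw [coeffCC_succPNat, mul_div_cancel_left₀ _ (by positivity)]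

lemma inversionCoeff_coeffCS {γ : ℂ → ℝ} (hγ : MemLp γ 2 (volume.restrict unitDisc)) (n : ℕ)
    (k : {k : ℕ // 1 ≤ k}) :
    inversionCoeff (coeffCS γ) n k = zernikeTransform γ (.inr (n, k)) := by
  rw [inversionCoeff_eq, zernikeTransform]
  simp only [zernikeWeight, zernike]
  rw [integral_mul_zernikeRadial_mul hγ (by fun_prop)]
  congr 1
  refine Finset.sum_congr rfl fun l _ => ?_
  rw [coeffCS_succPNat, mul_div_cancel_left₀ _ (by positivity)]

/-- The coefficient of index `n` involves the entries with `l ≤ n` only, and the last one has a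
nonzero factor: solve successively along the `k`-th superdiagonal. -/
lemma eq_of_inversionCoeff_eq {K L : Matrix ℕ+ ℕ+ ℝ} {k : ℕ}
    (h : ∀ n, inversionCoeff K n k = inversionCoeff L n k) (n : ℕ) :
    K n.succPNat (n + k).succPNat = L n.succPNat (n + k).succPNat := by
  induction n using Nat.strong_induction_on with
  | _ n ih =>
    have h1 := h n
    rw [inversionCoeff_eq, inversionCoeff_eq] at h1
    have h2 : (2 * (2 * n + k + 1) / Real.pi : ℝ) ≠ 0 := by positivity
    have h3 := mul_left_cancel₀ h2 h1
    rw [Finset.sum_range_succ, Finset.sum_range_succ, Finset.sum_congr rfl fun l hl => by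
      rw [ih l (Finset.mem_range.1 hl)]] at h3
    have h4 := mul_left_cancel₀ (zernikeCoeff_self_ne_zero n k) (add_left_cancel h3)
    exact (div_left_inj' (by positivity)).1 h4

lemma PNat.exists_succPNat_add {i j : ℕ+} (h : i ≤ j) :
    ∃ n k : ℕ, i = n.succPNat ∧ j = (n + k).succPNat := by
  have h' : (i : ℕ) ≤ j := h
  have hi := i.pos
  refine ⟨i - 1, j - i, PNat.eq ?_, PNat.eq ?_⟩ <;>
    simp only [Nat.succPNat_coe] <;> omega

lemma eq_of_isSymm_of_inversionCoeff_eq {K L : Matrix ℕ+ ℕ+ ℝ} (hK : K.IsSymm) (hL : L.IsSymm)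
    (h : ∀ n k, inversionCoeff K n k = inversionCoeff L n k) : K = L := by
  have key : ∀ i j : ℕ+, i ≤ j → K i j = L i j := by
    intro i j hij
    obtain ⟨n, k, rfl, rfl⟩ := PNat.exists_succPNat_add hij
    exact eq_of_inversionCoeff_eq (fun n => h n k) n
  ext i j
  rcases le_total i j with hij | hij
  · exact key i j hij
  · rw [← hK.apply, ← hL.apply]
    exact key j i hij

lemma eq_of_eq_neg_transpose_of_inversionCoeff_eq {K L : Matrix ℕ+ ℕ+ ℝ}
    (hK : K = -K.transpose) (hL : L = -L.transpose)
    (h : ∀ n k, 1 ≤ k → inversionCoeff K n k = inversionCoeff L n k) : K = L := by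
  have hK' : ∀ i j, K i j = -K j i := fun i j => congrFun (congrFun hK i) j
  have hL' : ∀ i j, L i j = -L j i := fun i j => congrFun (congrFun hL i) j
  have key : ∀ i j : ℕ+, i ≤ j → K i j = L i j := by
    intro i j hij
    obtain ⟨n, k, rfl, rfl⟩ := PNat.exists_succPNat_add hij
    rcases Nat.eq_zero_or_pos k with rfl | hk
    -- On the diagonal no data are given, but antisymmetry forces both entries to be zero.
    · have h1 := hK' n.succPNat n.succPNat
      have h2 := hL' n.succPNat n.succPNat
      rw [add_zero]
      linarith
    · exact eq_of_inversionCoeff_eq (fun n => h n k hk) n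
  ext i j
  rcases le_total i j with hij | hij
  · exact key i j hij
  · rw [hK', hL', key j i hij]

end

theorem mainTheorem5 (Kcc Kss Ksc Kcs : Matrix ℕ+ ℕ+ ℝ) :
    (∃ γ : ℂ → ℝ, MemLp γ 2 (volume.restrict unitDisc) ∧
      Kcc = coeffCC γ ∧ Kss = coeffSS γ ∧ Ksc = coeffSC γ ∧ Kcs = coeffCS γ) ↔
    (Kcc.IsSymm ∧ Kss.IsSymm ∧ Kcc = Kss ∧ Kcs = Ksc.transpose ∧
      Kcs = -Kcs.transpose ∧ Ksc = -Ksc.transpose ∧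
      Summable (fun x : ℕ × ℕ =>
        1 / (2 * x.1 + x.2 + 1 : ℝ) * inversionCoeff Kcc x.1 x.2 ^ 2) ∧
      Summable (fun x : ℕ × {k : ℕ // 1 ≤ k} =>
        1 / (2 * x.1 + (x.2 : ℕ) + 1 : ℝ) * inversionCoeff Kcs x.1 x.2 ^ 2)) := by
  constructor
  · rintro ⟨γ, hγ, rfl, rfl, rfl, rfl⟩
    have h := summable_zernikeTransform_sq hγ
    refine ⟨isSymm_coeffCC γ, coeffCC_eq_coeffSS γ ▸ isSymm_coeffCC γ, coeffCC_eq_coeffSS γ,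
      coeffCS_eq_transpose γ, coeffCS_eq_neg_transpose γ, ?_, ?_, ?_⟩
    · have h1 := congrArg Matrix.transpose (coeffCS_eq_neg_transpose γ)
      rwa [Matrix.transpose_neg, coeffCS_eq_transpose, Matrix.transpose_transpose] at h1
    · refine (h.comp_injective Sum.inl_injective).congr fun x => ?_
      rw [inversionCoeff_coeffCC hγ]
      rfl
    · refine (h.comp_injective Sum.inr_injective).congr fun x => ?_
      rw [inversionCoeff_coeffCS hγ]
      rfl
  · rintro ⟨h1, -, rfl, h3, h4, -, h6, h7⟩
    -- The two series are glued so that a single `γ` realizes the cosine and sine data together.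
    have hP : Summable fun i : ZernikeIndex => 1 / zernikeWeight i *
        (Sum.elim (fun x : ℕ × ℕ => inversionCoeff Kcc x.1 x.2)
          (fun x : ℕ × {k : ℕ // 1 ≤ k} => inversionCoeff Kcs x.1 x.2) i) ^ 2 :=
      Summable.sum _ h6 h7
    obtain ⟨γ, hγ, hT⟩ := exists_zernikeTransform_eq hP
    have hcc : Kcc = coeffCC γ := eq_of_isSymm_of_inversionCoeff_eq h1 (isSymm_coeffCC γ)
      fun n k => by rw [inversionCoeff_coeffCC hγ, hT, Sum.elim_inl]
    have hcs : Kcs = coeffCS γ := eq_of_eq_neg_transpose_of_inversionCoeff_eq h4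
      (coeffCS_eq_neg_transpose γ) fun n k hk => by
        rw [inversionCoeff_coeffCS hγ n ⟨k, hk⟩, hT, Sum.elim_inr]
    refine ⟨γ, hγ, hcc, hcc.trans (coeffCC_eq_coeffSS γ), ?_, hcs⟩
    rw [← Matrix.transpose_transpose Ksc, ← h3, hcs, coeffCS_eq_transpose,
      Matrix.transpose_transpose]
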